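/- Let $d,\nu\ge 1$ be integers. For $n\ge 0$ put $\Lambda_n=\{-n,\dots,n\}^d\subset\mathbb{Z}^d$, and let $|\cdot|_{\sup}$ be the sup-norm on $\mathbb{Z}^d$. Let $S\subset\{0,1\}^{\Lambda_\nu}$ be a parking scheme of radius $\nu$, that is, any set of local configurations that contains the zero configuration. Let $\omega=(\omega(x))_{x\in\mathbb{Z}^d}$ be a point of $(0,1)^{\mathbb{Z}^d}$ with the product $\lambda$ of the Lebesgue measures on $(0,1)$, and let $\mathbb{E}$ denote the expectation under $\lambda$. For a finite set $X\subset\mathbb{Z}^d$, the jamming limit $P_X(\omega)\in\{0,1\}^{\mathbb{Z}^d}$ of the parking process on $X$ with null boundary condition is the result of the following algorithm: start with the zero configuration $P$ and visit each site of $X$ once, in the order of increasing $\omega(x)$ (almost surely there are no ties; ties are broken arbitrarily); when $x$ is visited, set $P(x)=1$ if the configuration $y\mapsto P(x+y)$, $y\in\Lambda_\nu$, belongs to $S$, and leave $P$ unchanged otherwise. Write $P_n=P_{\Lambda_n}$, and let $$\rho_n(\omega)=\frac{1}{(2n+1)^d}\sum_{x\in\Lambda_n}P_n(\omega)(x)$$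 be the occupation density at the jamming limit $P_n$. The armour $\mathcal{A}(\{x\})(\omega)$ of a site $x$ is the set of all $y\in\mathbb{Z}^d$ for which there are $m\ge 0$ and a path $x=x_0,x_1,\dots,x_m=y$ in $\mathbb{Z}^d$ with $|x_{i+1}-x_i|_{\sup}\le\nu$ and $\omega(x_{i+1})<\omega(x_i)$ for $0\le i<m$; it is almost surely finite. The thermodynamic jamming limit $P(\omega)\in\{0,1\}^{\mathbb{Z}^d}$ is defined by $P(\omega)(x)=P_{\mathcal{A}(\{x\})(\omega)}(\omega)(x)$ if $\mathcal{A}(\{x\})(\omega)$ is finite, and by $P(\omega)(x)=0$ otherwise. Put $\rho=\mathbb{E}(P(0))$. Then $P(0)$ and all $\rho_n$ are integrable, and $$\lim_{n\to\infty}\mathbb{E}(\rho_n)=\rho .$$ -/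

import Mathlib

open MeasureTheory Filter Topology

namespace Parking

/-- Sites of the lattice `ℤ^d`. -/
abbrev Site (d : ℕ) : Type := Fin d → ℤ

/-- The box `Λ_n = {-n, …, n}^d`. -/
noncomputable def box (d n : ℕ) : Finset (Site d) := Fintype.piFinset fun _ => Finset.Icc (-(n : ℤ)) (n : ℤ)

/-- Configurations in `{0,1}^(ℤ^d)`. -/
abbrev Config (d : ℕ) : Type := Site d → Fin 2

/-- The sample space `(0,1)^(ℤ^d)`, with its product σ-algebra. -/
abbrev Sample (d : ℕ) : Type := Site d → Set.Ioo (0 : ℝ) 1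

/-- The uniform (Lebesgue) measure on `(0,1)`. -/
noncomputable def uniform : Measure (Set.Ioo (0 : ℝ) 1) := Measure.comap Subtype.val volume

instance isProbabilityMeasureUniform : IsProbabilityMeasure uniform := by
  constructor
  rw [uniform, comap_subtype_coe_apply measurableSet_Ioo, Set.image_univ, Subtype.range_coe,
    Real.volume_Ioo]
  norm_num

/-- The product over `ℤ^d` of the uniform measure on `(0,1)`. -/
noncomputable def sampleMeasure (d : ℕ) : Measure (Sample d) :=
  Measure.infinitePi fun _ : Site d => uniform

/-- A parking scheme of radius `ν`: a set of local configurations on `Λ_ν` that contains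
the zero configuration. -/
structure Scheme (d ν : ℕ) where
  allowed : Set (box d ν → Fin 2)
  zero_mem : (fun _ => 0) ∈ allowed

/-- The translation `θ_x`. -/
def shiftConfig {d : ℕ} (x : Site d) (P : Config d) : Config d := fun y => P (y + x)

/-- The restriction of a configuration to `Λ_ν`. -/
def restrictBox {d : ℕ} (ν : ℕ) (P : Config d) : box d ν → Fin 2 := fun y => P y

/-- The site of the nonempty finite set `R` that has the least `ω`-value (with probability one
there is only one such site; in case of ties it is some site with the least value). -/
noncomputable def nextSite {d : ℕ} (ω : Sample d) (R : Finset (Site d)) (hR : R.Nonempty) :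
    Site d :=
  (R.exists_min_image ω hR).choose

open Classical in
/-- One arrival. The state consists of the sites not chosen so far and the configuration. -/
noncomputable def arrival {d ν : ℕ} (S : Scheme d ν) (ω : Sample d)
    (s : Finset (Site d) × Config d) : Finset (Site d) × Config d :=
  if h : s.1.Nonempty then
    (s.1.erase (nextSite ω s.1 h),
      if restrictBox ν (shiftConfig (nextSite ω s.1 h) s.2) ∈ S.allowed then
        Function.update s.2 (nextSite ω s.1 h) 1
      else s.2)
  else s

/-- The jamming limit `P_X(ω)` of the parking process on the finite set `X` with null boundary
condition: start from the zero configuration and perform one arrival for each site of `X`. -/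
noncomputable def jamming {d ν : ℕ} (S : Scheme d ν) (X : Finset (Site d)) (ω : Sample d) :
    Config d :=
  ((arrival S ω)^[X.card] (X, fun _ => 0)).2

/-- `y ↑ x`: there is a path `x = p 0, …, p n = y` with steps of sup-norm at most `ν`
along which `ω` strictly decreases. -/
def Influences {d : ℕ} (ν : ℕ) (ω : Sample d) (y x : Site d) : Prop :=
  ∃ (n : ℕ) (p : Fin (n + 1) → Site d),
    (∀ (i : Fin n) (j : Fin d), |p i.succ j - p i.castSucc j| ≤ (ν : ℤ)) ∧
    StrictAnti (fun i => ω (p i)) ∧ p 0 = x ∧ p (Fin.last n) = y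

/-- The armour of a set of sites. -/
def armour {d : ℕ} (ν : ℕ) (ω : Sample d) (X : Set (Site d)) : Set (Site d) :=
  {y | ∃ x ∈ X, Influences ν ω y x}

open Classical in
/-- The thermodynamic jamming limit `P(ω)(x) = P_{A({x})(ω)}(ω)(x)`; the armour `A({x})` is
finite with probability one, and the value is set to `0` where it is infinite. -/
noncomputable def limitConfig {d ν : ℕ} (S : Scheme d ν) (ω : Sample d) : Config d := fun x =>
  if h : (armour ν ω {x}).Finite then jamming S h.toFinset ω x else 0

/-- The occupation density `ρ_n` of the jamming limit `P_n` in the box `Λ_n`. -/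
noncomputable def occupationDensity {d ν : ℕ} (S : Scheme d ν) (n : ℕ) (ω : Sample d) : ℝ :=
  (∑ x ∈ box d n, ((jamming S (box d n) ω x : ℕ) : ℝ)) / (2 * (n : ℝ) + 1) ^ d

/-- The limit density `ρ = E(P(0))`. -/
noncomputable def limitDensity {d ν : ℕ} (S : Scheme d ν) : ℝ :=
  ∫ ω, ((limitConfig S ω 0 : ℕ) : ℝ) ∂(sampleMeasure d)

end Parking

namespace Parking

/-! Without ties, the jamming limit on `X` is the unique solution of a local recursion: the value at
`x` is determined by the earlier sites of `x + Λ_ν` (`isJammed_jamming`, `IsJammed.eq_of_closed`).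
Hence it depends only on the armour of `x`, and as soon as `X` contains that armour the
finite-volume value equals the limiting one (`jamming_eq_limitConfig`).

Armours are rarely large. Arrival times decrease along `m + 1` given sites with probability at most
`1 / (m + 1)!` (`measure_strictAnti_le`), while only `(2ν + 1) ^ (d m)` paths of `m` steps leave the
origin. So decreasing paths of length `m` have vanishing probability as `m` grows, and without them
the armour of the origin lies in the box of radius `m ν` (`armour_subset_box`).

By stationarity (`integral_jamming_shift`), every site of `Λ_n` at depth at least `m ν` has
occupation probability within that small probability of `ρ`. The remaining boundary layer has a
vanishing share of the box as `n → ∞` with `m` fixed. -/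

variable {d ν : ℕ}

/-! ### The recursion behind the algorithm -/

/-- The part of a configuration that lives on the sites visited strictly before `x`. -/
noncomputable def earlier (ω : Sample d) (x : Site d) (P : Config d) : Config d :=
  fun y => if ω y < ω x then P y else 0

open Classical in
/-- The recursion that characterises the jamming limit on `X` when `ω` has no ties: a site of `X`
is occupied if and only if the configuration formed by the earlier sites allows it. -/
def IsJammed (S : Scheme d ν) (ω : Sample d) (X : Finset (Site d)) (P : Config d) : Prop :=
  ∀ x, P x =
    if x ∈ X ∧ restrictBox ν (shiftConfig x (earlier ω x P)) ∈ S.allowed then 1 else 0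

lemma mem_box {n : ℕ} {y : Site d} : y ∈ box d n ↔ ∀ j, |y j| ≤ (n : ℤ) := by
  simp [box, abs_le]

lemma nextSite_mem (ω : Sample d) (R : Finset (Site d)) (hR : R.Nonempty) :
    nextSite ω R hR ∈ R :=
  (R.exists_min_image ω hR).choose_spec.1

lemma nextSite_le (ω : Sample d) (R : Finset (Site d)) (hR : R.Nonempty) {y : Site d}
    (hy : y ∈ R) : ω (nextSite ω R hR) ≤ ω y :=
  (R.exists_min_image ω hR).choose_spec.2 y hy

open Classical in
/-- The invariant of the parking algorithm: the sites still to be visited come later than the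
visited ones, and the configuration satisfies the recursion on the visited sites. -/
structure ArrivalInvariant (S : Scheme d ν) (ω : Sample d) (X : Finset (Site d))
    (s : Finset (Site d) × Config d) : Prop where
  subset : s.1 ⊆ X
  lt : ∀ x ∈ X \ s.1, ∀ y ∈ s.1, ω x < ω y
  jammed : IsJammed S ω (X \ s.1) s.2

lemma IsJammed.eq_zero {S : Scheme d ν} {ω : Sample d} {X : Finset (Site d)} {P : Config d}
    (h : IsJammed S ω X P) {x : Site d} (hx : x ∉ X) : P x = 0 := by
  rw [h x, if_neg (fun h => hx h.1)]

lemma ArrivalInvariant.arrival {S : Scheme d ν} {ω : Sample d} (hω : Function.Injective ω)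
    {X : Finset (Site d)} {s : Finset (Site d) × Config d} (h : ArrivalInvariant S ω X s) :
    ArrivalInvariant S ω X (arrival S ω s) := by
  classical
  by_cases hs : s.1.Nonempty
  swap
  · rwa [Parking.arrival, dif_neg hs]
  set z := nextSite ω s.1 hs with hz
  have hzs : z ∈ s.1 := nextSite_mem ω s.1 hs
  have hzmin : ∀ y ∈ s.1.erase z, ω z < ω y := fun y hy =>
    lt_of_le_of_ne (nextSite_le ω s.1 hs (Finset.mem_of_mem_erase hy))
      (fun e => (Finset.ne_of_mem_erase hy) (hω e).symm)
  have hvis : ∀ x, x ∈ X \ s.1.erase z ↔ x = z ∨ x ∈ X \ s.1 := by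
    intro x
    simp only [Finset.mem_sdiff, Finset.mem_erase]
    constructor
    · tauto
    · rintro (rfl | hx)
      · exact ⟨h.subset hzs, by tauto⟩
      · tauto
  obtain ⟨R, P⟩ := s
  simp only at hs hz hzs hzmin hvis
  have hRP : Parking.arrival S ω (R, P) = (R.erase z,
      if restrictBox ν (shiftConfig z P) ∈ S.allowed then Function.update P z 1 else P) := by
    rw [Parking.arrival, dif_pos hs]
  set P' := if restrictBox ν (shiftConfig z P) ∈ S.allowed then Function.update P z 1 else P
    with hP'
  have hne : ∀ y, y ≠ z → P' y = P y := by
    intro y hy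
    rw [hP']
    split_ifs
    · rw [Function.update_of_ne hy]
    · rfl
  have hPz : P z = 0 := h.jammed.eq_zero (by simp [hzs])
  -- All visited sites precede `z` and `P` vanishes elsewhere, so truncating at `z` loses nothing:
  -- the test made by the algorithm is the one in the recursion.
  have hearly : earlier ω z P' = P := by
    funext y
    unfold earlier
    split_ifs with hy
    · exact hne y (fun e => by simp [e] at hy)
    · by_contra hc
      have : y ∈ X \ R := by
        by_contra hyX
        exact hc (h.jammed.eq_zero hyX).symm
      exact hy (h.lt y this z hzs)
  rw [hRP]
  refine ⟨(Finset.erase_subset _ _).trans h.subset, ?_, ?_⟩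
  · intro x hx y hy
    rcases (hvis x).1 hx with rfl | hx
    · exact hzmin y hy
    · exact h.lt x hx y (Finset.mem_of_mem_erase hy)
  · intro x
    simp only
    simp only [hvis x]
    by_cases hxz : x = z
    · rw [hxz, hearly]
      by_cases ha : restrictBox ν (shiftConfig z P) ∈ S.allowed
      · simp [hP', ha]
      · simp [hP', ha, hPz]
    · rw [hne x hxz, show P x = _ from h.jammed x]
      simp only [hxz, false_or]
      by_cases hx : x ∈ X \ R
      · have : earlier ω x P' = earlier ω x P := by
          funext y
          unfold earlier
          split_ifs with hy
          · exact hne y (fun e => lt_asymm (h.lt x hx z hzs) (e ▸ hy))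
          · rfl
        rw [this]
      · simp [hx]

lemma card_arrival_iterate (S : Scheme d ν) (ω : Sample d) (k : ℕ)
    (s : Finset (Site d) × Config d) : ((arrival S ω)^[k] s).1.card = s.1.card - k := by
  induction k generalizing s with
  | zero => rfl
  | succ k ih =>
    rw [Function.iterate_succ_apply, ih]
    by_cases hs : s.1.Nonempty
    · rw [arrival, dif_pos hs, Finset.card_erase_of_mem (nextSite_mem ω s.1 hs)]
      omega
    · have : s.1.card = 0 := by simpa using hs
      rw [arrival, dif_neg hs]
      omega

/-- Without ties the jamming limit satisfies the recursion. -/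
theorem isJammed_jamming (S : Scheme d ν) {ω : Sample d} (hω : Function.Injective ω)
    (X : Finset (Site d)) : IsJammed S ω X (jamming S X ω) := by
  classical
  have h0 : ArrivalInvariant S ω X (X, fun _ => 0) :=
    ⟨subset_rfl, by simp, fun x => by simp⟩
  have hk : ∀ k, ArrivalInvariant S ω X ((arrival S ω)^[k] (X, fun _ => 0)) := by
    intro k
    induction k with
    | zero => exact h0
    | succ k ih => rw [Function.iterate_succ_apply']; exact ih.arrival hω
  have hX := (hk X.card).jammed
  have he : ((arrival S ω)^[X.card] (X, fun _ => 0)).1 = ∅ := by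
    rw [← Finset.card_eq_zero, card_arrival_iterate]
    simp
  rwa [he, Finset.sdiff_empty] at hX

/-- Jamming limits on two finite sets agree on every set `A` that is closed under influence and
on which the two sets agree. -/
theorem IsJammed.eq_of_closed {S : Scheme d ν} {ω : Sample d} {X X' : Finset (Site d)}
    {P P' : Config d} (h : IsJammed S ω X P) (h' : IsJammed S ω X' P') {A : Set (Site d)}
    (hA : ∀ x ∈ A, ∀ y ∈ box d ν, ω (y + x) < ω x → y + x ∈ A)
    (hX : ∀ x ∈ A, x ∈ X ↔ x ∈ X') {x : Site d} (hx : x ∈ A) : P x = P' x := by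
  classical
  -- Induction on the number of sites of `X` earlier than `x`, which is finite even if `A` is not;
  -- neighbours outside `X` are empty in both configurations.
  induction hn : (X.filter (fun z => ω z < ω x)).card using Nat.strong_induction_on
    generalizing x with
  | _ n ih =>
    rw [h x, h' x]
    simp only [hX x hx]
    have : restrictBox ν (shiftConfig x (earlier ω x P)) =
        restrictBox ν (shiftConfig x (earlier ω x P')) := by
      funext y
      unfold restrictBox shiftConfig earlier
      split_ifs with hy
      · have hyA := hA x hx y y.2 hy
        by_cases hyX : (y : Site d) + x ∈ X
        · refine ih _ ?_ hyA rfl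
          rw [← hn]
          apply Finset.card_lt_card
          refine Finset.ssubset_iff_of_subset (fun z hz => ?_) |>.2 ⟨y + x, ?_, ?_⟩
          · simp only [Finset.mem_filter] at hz ⊢
            exact ⟨hz.1, hz.2.trans hy⟩
          · simpa using ⟨hyX, hy⟩
          · simp
        · rw [h.eq_zero hyX, h'.eq_zero (fun e => hyX ((hX _ hyA).2 e))]
      · rfl
    rw [this]

theorem IsJammed.unique {S : Scheme d ν} {ω : Sample d} {X : Finset (Site d)}
    {P P' : Config d} (h : IsJammed S ω X P) (h' : IsJammed S ω X P') : P = P' :=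
  funext fun x => h.eq_of_closed h' (A := Set.univ) (by simp) (by simp) (Set.mem_univ x)

/-- The recursion is translation covariant. -/
theorem IsJammed.shift {S : Scheme d ν} {ω : Sample d} {X X' : Finset (Site d)} {P : Config d}
    (h : IsJammed S ω X P) (a : Site d) (hX : ∀ y, y ∈ X' ↔ y + a ∈ X) :
    IsJammed S (fun y => ω (y + a)) X' (fun y => P (y + a)) := by
  intro x
  refine (h (x + a)).trans ?_
  have : restrictBox ν (shiftConfig (x + a) (earlier ω (x + a) P)) = restrictBox ν
      (shiftConfig x (earlier (fun y => ω (y + a)) x (fun y => P (y + a)))) := by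
    funext y
    simp only [restrictBox, shiftConfig, earlier, add_assoc]
  have hiff := and_congr (hX x) (iff_of_eq (congrArg (· ∈ S.allowed) this)).symm
  split_ifs with h1 h2 h2
  · rfl
  · exact absurd (hiff.2 h1) h2
  · exact absurd (hiff.1 h2) h1
  · rfl

/-! ### Armours and locality -/

lemma mem_armour_self (ω : Sample d) (x : Site d) : x ∈ armour ν ω {x} := by
  refine ⟨x, rfl, 0, fun _ => x, fun i => i.elim0, fun i j hij => ?_, rfl, rfl⟩
  exact absurd hij (by simp [Fin.fin_one_eq_zero])

/-- Armours are closed under influence. -/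
lemma armour_closed {ω : Sample d} {a x : Site d} (hx : x ∈ armour ν ω {a}) {y : Site d}
    (hy : y ∈ box d ν) (hlt : ω (y + x) < ω x) : y + x ∈ armour ν ω {a} := by
  obtain ⟨a', ha', n, p, hp, hanti, h0, hl⟩ := hx
  refine ⟨a', ha', n + 1, Fin.snoc (α := fun _ => Site d) p (y + x), ?_, ?_, ?_, ?_⟩
  · intro i j
    induction i using Fin.lastCases with
    | last =>
      simp only [Fin.succ_last, Fin.snoc_last, Fin.snoc_castSucc, hl]
      simpa using mem_box.1 hy j
    | cast i =>
      rw [Fin.succ_castSucc, Fin.snoc_castSucc, Fin.snoc_castSucc]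
      exact hp i j
  · rw [Fin.strictAnti_iff_succ_lt]
    intro i
    induction i using Fin.lastCases with
    | last => simpa only [Fin.succ_last, Fin.snoc_last, Fin.snoc_castSucc, hl] using hlt
    | cast i =>
      rw [Fin.succ_castSucc, Fin.snoc_castSucc, Fin.snoc_castSucc]
      exact hanti (Fin.castSucc_lt_succ)
  · rw [← Fin.castSucc_zero, Fin.snoc_castSucc, h0]
  · simp

/-- If the armour of `x` lies in `X`, the jamming limit on `X` has the limiting value at `x`. -/
theorem jamming_eq_limitConfig (S : Scheme d ν) {ω : Sample d} (hω : Function.Injective ω)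
    {X : Finset (Site d)} {x : Site d} (h : armour ν ω {x} ⊆ X) :
    jamming S X ω x = limitConfig S ω x := by
  have hfin : (armour ν ω {x}).Finite := X.finite_toSet.subset h
  rw [limitConfig, dif_pos hfin]
  refine (isJammed_jamming S hω X).eq_of_closed (isJammed_jamming S hω _)
    (A := armour ν ω {x}) (fun z hz y hy hlt => armour_closed hz hy hlt) (fun z hz => ?_)
    (mem_armour_self ω x)
  simpa [hz] using h hz

theorem jamming_shift (S : Scheme d ν) {ω : Sample d} (hω : Function.Injective ω)
    {X X' : Finset (Site d)} (a : Site d) (hX : ∀ y, y ∈ X' ↔ y + a ∈ X) (x : Site d) :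
    jamming S X' (fun y => ω (y + a)) x = jamming S X ω (x + a) := by
  have hω' : Function.Injective (fun y => ω (y + a)) := hω.comp (add_left_injective a)
  exact congrFun ((isJammed_jamming S hω' X').unique
    ((isJammed_jamming S hω X).shift a hX)) x

/-! ### Measurability, absence of ties, stationarity -/

/-- The jamming limit depends only on the order of the arrival times, ties included. -/
theorem jamming_congr (S : Scheme d ν) {X : Finset (Site d)} {ω ω' : Sample d}
    (h : ∀ x ∈ X, ∀ y ∈ X, ω x ≤ ω y ↔ ω' x ≤ ω' y) : jamming S X ω = jamming S X ω' := by
  have choose_congr : ∀ {p q : Site d → Prop} (hp : ∃ x, p x) (hq : ∃ x, q x), p = q →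
      hp.choose = hq.choose := by
    rintro p q hp hq rfl
    rfl
  have hnext : ∀ R (hR : R.Nonempty), R ⊆ X → nextSite ω R hR = nextSite ω' R hR := by
    intro R hR hRX
    refine choose_congr _ _ (funext fun x => propext ?_)
    exact and_congr_right fun hx => forall₂_congr fun y hy => h x (hRX hx) y (hRX hy)
  have harr : ∀ s : Finset (Site d) × Config d, s.1 ⊆ X → arrival S ω s = arrival S ω' s := by
    intro s hs
    by_cases hne : s.1.Nonempty
    · rw [arrival, arrival, dif_pos hne, dif_pos hne, hnext _ hne hs]
    · rw [arrival, arrival, dif_neg hne, dif_neg hne]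
  have hiter : ∀ k, ((arrival S ω)^[k] (X, fun _ => 0)) = ((arrival S ω')^[k] (X, fun _ => 0)) ∧
      ((arrival S ω)^[k] (X, fun _ => 0)).1 ⊆ X := by
    intro k
    induction k with
    | zero => exact ⟨rfl, subset_rfl⟩
    | succ k ih =>
      rw [Function.iterate_succ_apply', Function.iterate_succ_apply', ← ih.1]
      refine ⟨harr _ ih.2, ?_⟩
      unfold arrival
      split
      · exact (Finset.erase_subset _ _).trans ih.2
      · exact ih.2
  exact congrArg Prod.snd (hiter _).1

/-- The algorithm only compares arrival times, so the value factors through the order pattern on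
`X`, which ranges over a finite type. -/
theorem measurable_jamming (S : Scheme d ν) (X : Finset (Site d)) (x : Site d) :
    Measurable (fun ω => jamming S X ω x) := by
  let g : Sample d → (X × X → Prop) := fun ω z => ω z.1 ≤ ω z.2
  have hg : Measurable g := by
    refine measurable_pi_lambda _ fun z => measurableSet_setOfPred.1 ?_
    exact measurableSet_le (measurable_pi_apply _) (measurable_pi_apply _)
  have hf : (fun ω => jamming S X ω x).FactorsThrough g := by
    intro ω ω' h
    refine congrFun (jamming_congr S fun a ha b hb => ?_) x
    exact iff_of_eq (congrFun h (⟨a, ha⟩, ⟨b, hb⟩))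
  rw [← hf.extend_comp (fun _ => 0)]
  exact (measurable_of_countable _).comp hg

instance (d : ℕ) : IsProbabilityMeasure (sampleMeasure d) := by
  unfold sampleMeasure
  infer_instance

instance : NullSingletonClass uniform := by
  refine ⟨fun a => ?_⟩
  rw [uniform, comap_subtype_coe_apply measurableSet_Ioo, Set.image_singleton, measure_singleton]

/-- Almost surely there are no ties. -/
theorem ae_injective (d : ℕ) : ∀ᵐ ω ∂(sampleMeasure d), Function.Injective ω := by
  have h : ∀ x y : Site d, x ≠ y → ∀ᵐ ω ∂(sampleMeasure d), ω x ≠ ω y := by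
    intro x y hxy
    have hmap : (sampleMeasure d).map (fun ω => (ω x, ω y)) = uniform.prod uniform :=
      Measure.infinitePi_map_eval_prod hxy
    have hd : ∀ᵐ z ∂(uniform.prod uniform), z.1 ≠ z.2 := by
      have hm : MeasurableSet {z : Set.Ioo (0 : ℝ) 1 × Set.Ioo (0 : ℝ) 1 | z.1 = z.2} :=
        measurableSet_eq_fun measurable_fst measurable_snd
      rw [ae_iff]
      simp only [ne_eq, not_not]
      -- The diagonal is null because each of its sections is a single point.
      rw [Measure.measure_prod_null hm]
      refine .of_forall fun a => ?_
      have : Prod.mk a ⁻¹' {z : Set.Ioo (0 : ℝ) 1 × Set.Ioo (0 : ℝ) 1 | z.1 = z.2} = {a} := by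
        ext b
        simp [eq_comm]
      simp only [this, measure_singleton, Pi.zero_apply]
    rw [← hmap] at hd
    exact ae_of_ae_map (f := fun ω : Sample d => (ω x, ω y)) (by fun_prop) hd
  have h' : ∀ᵐ ω ∂(sampleMeasure d), ∀ x y : Site d, x ≠ y → ω x ≠ ω y := by
    rw [ae_all_iff]; intro x
    rw [ae_all_iff]; intro y
    rw [ae_all_iff]
    exact h x y
  filter_upwards [h'] with ω hω x y hxy
  by_contra hne
  exact hω x y hne hxy

theorem measurePreserving_shift (a : Site d) :
    MeasurePreserving (fun (ω : Sample d) (y : Site d) => ω (y + a))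
      (sampleMeasure d) (sampleMeasure d) :=
  ⟨by fun_prop, Measure.map_infinitePi_infinitePi_of_inj (P := fun _ : Site d => uniform)
    (add_left_injective a)⟩

/-! ### Long decreasing paths are improbable -/

lemma measurableSet_strictAnti {k : ℕ} (p : Fin k → Site d) :
    MeasurableSet {ω : Sample d | StrictAnti (fun i => ω (p i))} := by
  simp only [StrictAnti, Set.ofPred_forall]
  refine .iInter fun a => .iInter fun b => .iInter fun _ => ?_
  exact measurableSet_lt (measurable_pi_apply _) (measurable_pi_apply _)

/-- The probability that the arrival times decrease along `k` given sites is at most `1 / k!`. -/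
theorem measure_strictAnti_le {k : ℕ} (p : Fin k → Site d) :
    sampleMeasure d {ω | StrictAnti (fun i => ω (p i))} ≤ ((k.factorial : ℕ) : ENNReal)⁻¹ := by
  by_cases hp : Function.Injective p
  swap
  · have : {ω : Sample d | StrictAnti (fun i => ω (p i))} = ∅ := by
      ext ω
      simp only [Set.mem_ofPred_eq, Set.mem_empty_iff_false, iff_false]
      exact fun h => hp (Function.Injective.of_comp (f := ω) h.injective)
    rw [this, measure_empty]
    exact zero_le
  -- The `k!` orderings of the sites give disjoint events of equal probability.
  let E : Equiv.Perm (Fin k) → Set (Sample d) := fun σ => {ω | StrictAnti (fun i => ω (p (σ i)))}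
  have hm : ∀ σ, MeasurableSet (E σ) := fun σ => measurableSet_strictAnti (fun i => p (σ i))
  have hE : ∀ σ, sampleMeasure d (E σ) = sampleMeasure d (E 1) := by
    have key : ∀ σ : Equiv.Perm (Fin k), sampleMeasure d (E σ) =
        Measure.infinitePi (fun _ : Fin k => uniform) {f | StrictAnti f} := by
      intro σ
      have hinj : Function.Injective (fun i => p (σ i)) := hp.comp σ.injective
      have := Measure.map_infinitePi_infinitePi_of_inj (P := fun _ : Site d => uniform) hinj
      rw [← this, Measure.map_apply (by fun_prop)]
      · rfl
      · simp only [StrictAnti, Set.ofPred_forall]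
        refine .iInter fun a => .iInter fun b => .iInter fun _ => ?_
        exact measurableSet_lt (measurable_pi_apply _) (measurable_pi_apply _)
    exact fun σ => (key σ).trans (key 1).symm
  have hdisj : Pairwise (Function.onFun Disjoint E) := by
    intro σ τ hne
    refine Set.disjoint_left.2 fun ω hσ hτ => hne ?_
    -- Two strictly decreasing enumerations of the same values coincide, which forces `σ = τ`.
    have hr : Set.range (fun i => ω (p (σ i))) = Set.range (fun i => ω (p (τ i))) := by
      have : ∀ ρ : Equiv.Perm (Fin k),
          Set.range (fun i => ω (p (ρ i))) = Set.range (fun i => ω (p i)) :=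
        fun ρ => ρ.surjective.range_comp (fun i => ω (p i))
      rw [this, this]
    have heq := (StrictAnti.range_inj hσ hτ).1 hr
    have hinj : Function.Injective (fun i => ω (p i)) := by
      have h := (show StrictAnti (fun i => ω (p (σ i))) from hσ).injective.comp σ.symm.injective
      simpa [Function.comp_def] using h
    exact Equiv.ext fun i => hinj (congrFun heq i)
  have hsum : ∑ σ, sampleMeasure d (E σ) ≤ 1 := by
    rw [← tsum_fintype (L := .unconditional _), ← measure_iUnion hdisj hm]
    exact prob_le_one
  simp only [hE, Finset.sum_const, Finset.card_univ, Fintype.card_perm, Fintype.card_fin,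
    nsmul_eq_mul] at hsum
  rw [ENNReal.le_inv_iff_mul_le, mul_comm]
  exact hsum

/-- Some path of length `m` that starts at the origin and has steps in `Λ_ν` has decreasing
arrival times. -/
def longPath (d ν m : ℕ) : Set (Sample d) :=
  ⋃ s : Fin m → box d ν,
    {ω | StrictAnti (fun i => ω (Fin.partialSum (fun j => (s j : Site d)) i))}

lemma measurableSet_longPath (d ν m : ℕ) : MeasurableSet (longPath d ν m) :=
  .iUnion fun _ => measurableSet_strictAnti _

lemma card_box (d n : ℕ) : (box d n).card = (2 * n + 1) ^ d := by
  rw [box, Fintype.card_piFinset_const, Int.card_Icc]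
  congr 1
  omega

/-- Union bound over the step sequences; `m` steps involve `m + 1` sites, whence the factorial. -/
lemma measure_longPath_le (d ν m : ℕ) : (sampleMeasure d).real (longPath d ν m) ≤
    (((2 * ν + 1) ^ d : ℕ) : ℝ) ^ m / ((m + 1).factorial : ℝ) := by
  have h : sampleMeasure d (longPath d ν m) ≤
      (((((2 * ν + 1) ^ d) ^ m : ℕ) : ENNReal)) * (((m + 1).factorial : ℕ) : ENNReal)⁻¹ := by
    refine (measure_iUnion_fintype_le _ _).trans ?_
    refine (Finset.sum_le_sum fun s _ => measure_strictAnti_le _).trans ?_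
    rw [Finset.sum_const, nsmul_eq_mul]
    simp [card_box]
  have := ENNReal.toReal_mono
    (ENNReal.mul_ne_top (ENNReal.natCast_ne_top _) (by simp [Nat.factorial_ne_zero])) h
  rw [Measure.real]
  refine this.trans_eq ?_
  rw [ENNReal.toReal_mul, ENNReal.toReal_inv, ENNReal.toReal_natCast, ENNReal.toReal_natCast,
    div_eq_mul_inv]
  push_cast
  rfl

lemma tendsto_measure_longPath (d ν : ℕ) :
    Tendsto (fun m => (sampleMeasure d).real (longPath d ν m)) atTop (𝓝 0) := by
  refine squeeze_zero (fun _ => measureReal_nonneg) (measure_longPath_le d ν) ?_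
  refine squeeze_zero (fun m => by positivity) (fun m => ?_)
    (FloorSemiring.tendsto_pow_div_factorial_atTop (((2 * ν + 1) ^ d : ℕ) : ℝ))
  gcongr
  omega

lemma abs_partialSum_le {m : ℕ} (s : Fin m → Site d) (hs : ∀ i, s i ∈ box d ν)
    (i : Fin (m + 1)) (j : Fin d) : |Fin.partialSum s i j| ≤ (i : ℤ) * ν := by
  induction i using Fin.induction with
  | zero => simp
  | succ i ih =>
    rw [Fin.partialSum_succ, Pi.add_apply]
    refine (abs_add_le _ _).trans ?_
    have := mem_box.1 (hs i) j
    simp only [Fin.val_castSucc, Fin.val_succ] at ih ⊢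
    push_cast
    linarith

lemma exists_steps {m : ℕ} (p : Fin (m + 1) → Site d) (h0 : p 0 = 0)
    (hp : ∀ (i : Fin m) (j : Fin d), |p i.succ j - p i.castSucc j| ≤ (ν : ℤ)) :
    ∃ s : Fin m → box d ν, Fin.partialSum (fun j => (s j : Site d)) = p := by
  refine ⟨fun i => ⟨p i.succ - p i.castSucc, mem_box.2 (hp i)⟩, funext fun i => ?_⟩
  induction i using Fin.induction with
  | zero => simp [h0]
  | succ i ih => rw [Fin.partialSum_succ, ih]; simp

/-- In the absence of long decreasing paths the armour of the origin is confined to a box. -/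
theorem armour_subset_box {ω : Sample d} {m : ℕ} (h : ω ∉ longPath d ν m) :
    armour ν ω {0} ⊆ (box d (m * ν) : Set (Site d)) := by
  rintro y ⟨x, rfl, n, p, hp, hanti, h0, rfl⟩
  -- Otherwise the first `m` steps of the path would already put `ω` in `longPath d ν m`.
  have hn : n < m := by
    by_contra hmn
    push Not at hmn
    apply h
    have hc : m + 1 ≤ n + 1 := by omega
    obtain ⟨s, hs⟩ := exists_steps (fun i : Fin (m + 1) => p (Fin.castLE hc i)) h0
      (fun i j => hp (Fin.castLE hmn i) j)
    refine Set.mem_iUnion.2 ⟨s, ?_⟩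
    rw [hs]
    exact fun a b hab => hanti (by simpa using hab)
  obtain ⟨s, hs⟩ := exists_steps p h0 hp
  rw [Finset.mem_coe, mem_box]
  intro j
  have := abs_partialSum_le (fun j => (s j : Site d)) (fun i => (s i).2) (Fin.last n) j
  rw [hs, Fin.val_last] at this
  refine this.trans ?_
  push_cast
  gcongr

lemma box_mono {m n : ℕ} (h : m ≤ n) : box d m ⊆ box d n := by
  intro y hy
  rw [mem_box] at hy ⊢
  exact fun j => (hy j).trans (by exact_mod_cast h)

lemma ae_exists_notMem_longPath (d ν : ℕ) :
    ∀ᵐ ω ∂(sampleMeasure d), ∃ m, ω ∉ longPath d ν m := by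
  have h : (sampleMeasure d).real {ω | ¬ ∃ m, ω ∉ longPath d ν m} ≤ 0 := by
    refine ge_of_tendsto' (tendsto_measure_longPath d ν) fun m => ?_
    refine measureReal_mono fun ω hω => ?_
    simp only [not_exists, not_not, Set.mem_ofPred_eq] at hω
    exact hω m
  rw [ae_iff]
  exact (measureReal_eq_zero_iff).1 (le_antisymm h measureReal_nonneg)

lemma jamming_eq_limitConfig_of_notMem_longPath (S : Scheme d ν) {ω : Sample d}
    (hω : Function.Injective ω) {m : ℕ} (hm : ω ∉ longPath d ν m) {X : Finset (Site d)}
    (hX : box d (m * ν) ⊆ X) : jamming S X ω 0 = limitConfig S ω 0 :=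
  jamming_eq_limitConfig S hω
    ((armour_subset_box hm).trans (Finset.coe_subset.2 hX))

/-! ### Integrability -/

lemma cast_fin_two_mem_Icc (a : Fin 2) : ((a : ℕ) : ℝ) ∈ Set.Icc (0 : ℝ) 1 :=
  ⟨by positivity, by exact_mod_cast Nat.lt_succ_iff.1 a.2⟩

lemma integrable_jamming (S : Scheme d ν) (X : Finset (Site d)) (x : Site d) :
    Integrable (fun ω => ((jamming S X ω x : ℕ) : ℝ)) (sampleMeasure d) := by
  refine Integrable.of_mem_Icc 0 1 ?_ (.of_forall fun ω => cast_fin_two_mem_Icc _)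
  exact ((measurable_of_countable (fun a : Fin 2 => ((a : ℕ) : ℝ))).comp
    (measurable_jamming S X x)).aemeasurable

/-- Measurability comes from an almost sure limit: the values at the origin for growing boxes are
eventually constant. -/
theorem integrable_limitConfig (S : Scheme d ν) :
    Integrable (fun ω => ((limitConfig S ω 0 : ℕ) : ℝ)) (sampleMeasure d) := by
  refine Integrable.of_mem_Icc 0 1 ?_ (.of_forall fun ω => cast_fin_two_mem_Icc _)
  refine aemeasurable_of_tendsto_metrizable_ae atTop
    (f := fun n ω => ((jamming S (box d n) ω 0 : ℕ) : ℝ))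
    (fun n => (integrable_jamming S (box d n) 0).1.aemeasurable) ?_
  filter_upwards [ae_injective d, ae_exists_notMem_longPath d ν] with ω hω ⟨m, hm⟩
  refine tendsto_const_nhds.congr' ?_
  filter_upwards [eventually_ge_atTop (m * ν)] with n hn
  rw [jamming_eq_limitConfig_of_notMem_longPath S hω hm (box_mono hn)]

theorem integrable_occupationDensity (S : Scheme d ν) (n : ℕ) :
    Integrable (occupationDensity S n) (sampleMeasure d) :=
  (integrable_finsetSum _ fun x _ => integrable_jamming S (box d n) x).div_const _

/-! ### Comparison of expectations and the limit -/

/-- By stationarity, the occupation probability of `x` in a box is that of the origin in a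
translate of the box. -/
lemma integral_jamming_shift (S : Scheme d ν) {X X' : Finset (Site d)} (x : Site d)
    (hX : ∀ y, y ∈ X' ↔ y + x ∈ X) :
    ∫ ω, ((jamming S X ω x : ℕ) : ℝ) ∂(sampleMeasure d) =
      ∫ ω, ((jamming S X' ω 0 : ℕ) : ℝ) ∂(sampleMeasure d) := by
  have hmp := measurePreserving_shift (d := d) x
  have hint := (integrable_jamming S X' 0).1
  rw [← hmp.map_eq] at hint
  rw [← hmp.map_eq, integral_map hmp.measurable.aemeasurable hint, hmp.map_eq]
  refine integral_congr_ae ?_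
  filter_upwards [ae_injective d] with ω hω
  rw [jamming_shift S hω x hX, zero_add]

lemma abs_sub_le_one {a b : ℝ} (ha : a ∈ Set.Icc (0 : ℝ) 1) (hb : b ∈ Set.Icc (0 : ℝ) 1) :
    |a - b| ≤ 1 := by
  rw [abs_le]
  constructor <;> linarith [ha.1, ha.2, hb.1, hb.2]

lemma abs_integral_jamming_sub_le_one (S : Scheme d ν) (X : Finset (Site d)) (x : Site d) :
    |∫ ω, ((jamming S X ω x : ℕ) : ℝ) ∂(sampleMeasure d) - limitDensity S| ≤ 1 := by
  rw [limitDensity, ← integral_sub (integrable_jamming S X x) (integrable_limitConfig S)]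
  have := norm_integral_le_of_norm_le_const (μ := sampleMeasure d) (C := 1)
    (f := fun ω => ((jamming S X ω x : ℕ) : ℝ) - ((limitConfig S ω 0 : ℕ) : ℝ))
    (.of_forall fun ω => abs_sub_le_one (cast_fin_two_mem_Icc _) (cast_fin_two_mem_Icc _))
  simpa using this

/-- If `X` contains a large box around the origin, the occupation probability of the origin is
close to its limit. -/
lemma abs_integral_jamming_sub_le (S : Scheme d ν) {X : Finset (Site d)} {m : ℕ}
    (hX : box d (m * ν) ⊆ X) :
    |∫ ω, ((jamming S X ω 0 : ℕ) : ℝ) ∂(sampleMeasure d) - limitDensity S| ≤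
      (sampleMeasure d).real (longPath d ν m) := by
  rw [limitDensity, ← integral_sub (integrable_jamming S X 0) (integrable_limitConfig S),
    ← integral_indicator_one (measurableSet_longPath d ν m)]
  refine (abs_integral_le_integral_abs).trans (integral_mono_ae ?_ ?_ ?_)
  · exact ((integrable_jamming S X 0).sub (integrable_limitConfig S)).abs
  · exact (integrable_const (1 : ℝ)).indicator (measurableSet_longPath d ν m)
  · filter_upwards [ae_injective d] with ω hω
    by_cases hm : ω ∈ longPath d ν m
    · rw [Set.indicator_of_mem hm]
      exact abs_sub_le_one (cast_fin_two_mem_Icc _) (cast_fin_two_mem_Icc _)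
    · rw [Set.indicator_of_notMem hm,
        jamming_eq_limitConfig_of_notMem_longPath S hω hm hX, sub_self, abs_zero]

lemma abs_integral_jamming_box_sub_le (S : Scheme d ν) {m n : ℕ} (hmn : m * ν ≤ n) {x : Site d}
    (hx : x ∈ box d (n - m * ν)) :
    |∫ ω, ((jamming S (box d n) ω x : ℕ) : ℝ) ∂(sampleMeasure d) - limitDensity S| ≤
      (sampleMeasure d).real (longPath d ν m) := by
  have hX : ∀ y, y ∈ (box d n).image (fun z => z - x) ↔ y + x ∈ box d n := by
    intro y
    rw [Finset.mem_image]
    exact ⟨by rintro ⟨z, hz, rfl⟩; simpa using hz, fun h => ⟨y + x, h, by simp⟩⟩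
  rw [integral_jamming_shift S x hX]
  -- The box translated by `-x` still contains the box of radius `m ν`, since `(n - m ν) + m ν = n`.
  refine abs_integral_jamming_sub_le S fun y hy => (hX y).2 ?_
  rw [mem_box] at hx hy ⊢
  intro j
  have h1 := hx j
  have h2 := hy j
  rw [Nat.cast_sub hmn] at h1
  rw [Pi.add_apply]
  exact (abs_add_le _ _).trans (by linarith)

/-- Sites of the inner box contribute an error of at most `ε` each, boundary sites at most `1` each;
the second term is the boundary fraction. -/
lemma abs_integral_occupationDensity_sub_le (S : Scheme d ν) {m n : ℕ} (hmn : m * ν ≤ n) :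
    |∫ ω, occupationDensity S n ω ∂(sampleMeasure d) - limitDensity S| ≤
      (sampleMeasure d).real (longPath d ν m) +
        (1 - ((2 * ((n - m * ν : ℕ) : ℝ) + 1) / (2 * (n : ℝ) + 1)) ^ d) := by
  set ε := (sampleMeasure d).real (longPath d ν m) with hε
  set f : Site d → ℝ := fun x =>
    ∫ ω, ((jamming S (box d n) ω x : ℕ) : ℝ) ∂(sampleMeasure d) with hf
  set N : ℝ := (2 * (n : ℝ) + 1) ^ d with hN
  have hN0 : 0 < N := by positivity
  have hcard : ∀ k : ℕ, ((box d k).card : ℝ) = (2 * (k : ℝ) + 1) ^ d := by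
    intro k
    rw [card_box]
    push_cast
    rfl
  have hsub : box d (n - m * ν) ⊆ box d n := box_mono (Nat.sub_le _ _)
  have hint : ∫ ω, occupationDensity S n ω ∂(sampleMeasure d) = (∑ x ∈ box d n, f x) / N := by
    unfold occupationDensity
    rw [integral_div, integral_finsetSum _ fun x _ => integrable_jamming S (box d n) x]
  have hdiff : (∑ x ∈ box d n, f x) / N - limitDensity S =
      (∑ x ∈ box d n, (f x - limitDensity S)) / N := by
    rw [Finset.sum_sub_distrib, Finset.sum_const, nsmul_eq_mul, hcard n, ← hN]
    field_simp
  have hsum : ∑ x ∈ box d n, |f x - limitDensity S| ≤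
      N * ε + (N - (2 * ((n - m * ν : ℕ) : ℝ) + 1) ^ d) := by
    rw [← Finset.sum_sdiff hsub, add_comm]
    refine add_le_add ?_ ?_
    · refine (Finset.sum_le_card_nsmul _ _ ε
        fun x hx => abs_integral_jamming_box_sub_le S hmn hx).trans ?_
      rw [nsmul_eq_mul, hN, ← hcard n]
      have : (0 : ℝ) ≤ ε := measureReal_nonneg
      gcongr
    · refine (Finset.sum_le_card_nsmul _ _ 1
        fun x _ => abs_integral_jamming_sub_le_one S _ x).trans_eq ?_
      rw [nsmul_eq_mul, mul_one, Finset.cast_card_sdiff hsub, hcard, hcard]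
  rw [hint, hdiff, abs_div, abs_of_pos hN0, div_le_iff₀ hN0]
  refine ((Finset.abs_sum_le_sum_abs _ _).trans hsum).trans_eq ?_
  rw [div_pow, ← hN]
  field_simp

lemma tendsto_box_ratio (d k : ℕ) :
    Tendsto (fun n : ℕ => 1 - ((2 * ((n - k : ℕ) : ℝ) + 1) / (2 * (n : ℝ) + 1)) ^ d)
      atTop (𝓝 0) := by
  have h1 : Tendsto (fun n : ℕ => 2 * (n : ℝ) + 1) atTop atTop :=
    tendsto_atTop_add_const_right _ _
      (tendsto_natCast_atTop_atTop.const_mul_atTop (by norm_num))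
  have h2 : Tendsto (fun n : ℕ => 1 - (2 * (k : ℝ)) / (2 * (n : ℝ) + 1)) atTop (𝓝 (1 - 0)) :=
    (h1.const_div_atTop _).const_sub 1
  have h3 : Tendsto (fun n : ℕ => (2 * ((n - k : ℕ) : ℝ) + 1) / (2 * (n : ℝ) + 1)) atTop
      (𝓝 1) := by
    rw [sub_zero] at h2
    refine h2.congr' ?_
    filter_upwards [eventually_ge_atTop k] with n hn
    rw [Nat.cast_sub hn]
    field_simp
    ring
  simpa using (h3.pow d).const_sub 1

theorem tendsto_integral_occupationDensity (S : Scheme d ν) :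
    Tendsto (fun n : ℕ => ∫ ω, occupationDensity S n ω ∂(sampleMeasure d))
      atTop (𝓝 (limitDensity S)) := by
  rw [Metric.tendsto_atTop']
  intro δ hδ
  -- First `m` is fixed to make long paths unlikely, then `n` is taken large to make the boundary
  -- layer of width `m ν` negligible.
  obtain ⟨m, hm⟩ :=
    ((tendsto_measure_longPath d ν).eventually_lt_const (half_pos hδ)).exists
  obtain ⟨n₀, hn₀⟩ := eventually_atTop.1
    ((tendsto_box_ratio d (m * ν)).eventually_lt_const (half_pos hδ))
  refine ⟨max n₀ (m * ν), fun n hn => ?_⟩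
  have h1 := abs_integral_occupationDensity_sub_le S ((le_max_right n₀ (m * ν)).trans hn.le)
  have h2 := hn₀ n ((le_max_left _ _).trans hn.le)
  rw [Real.dist_eq]
  linarith

end Parking

/-- The expectations of the occupation densities converge to `ρ = E(P(0))`. The integrability
clauses say that all the expectations involved are genuine. -/
theorem corollary4p3 (d ν : ℕ) (hd : 1 ≤ d) (hν : 1 ≤ ν) (S : Parking.Scheme d ν) :
    (∀ n : ℕ, Integrable (Parking.occupationDensity S n) (Parking.sampleMeasure d)) ∧
    Integrable (fun ω => ((Parking.limitConfig S ω 0 : ℕ) : ℝ)) (Parking.sampleMeasure d) ∧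
    Tendsto (fun n : ℕ => ∫ ω, Parking.occupationDensity S n ω ∂(Parking.sampleMeasure d))
      atTop (𝓝 (Parking.limitDensity S)) :=
  ⟨Parking.integrable_occupationDensity S, Parking.integrable_limitConfig S,
    Parking.tendsto_integral_occupationDensity S⟩
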